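/- For a field $F$, a non-constant polynomial $h\in F[x]$ in one variable is called decomposable in $F[x]$ if $h=u(g(x))$ with $u,g\in F[x]$ both of degree $\geq 2$, and indecomposable in $F[x]$ otherwise. A non-constant polynomial $h\in F[t,x]$ in two variables is called decomposable in $F[t,x]$ if $h=u(g(t,x))$ with $u$ a one-variable polynomial over $F$ of degree $\geq 2$ and $g\in F[t,x]$ (of any degree), and indecomposable in $F[t,x]$ otherwise. Theorem. Let $k$ be a field with algebraic closure $\overline k$, and let $f(t,x)\in\overline k[t,x]$ be a non-constant polynomial that is indecomposable in $\overline k[t,x]$. Assume that the characteristic $p$ of $k$ satisfies $p=0$ or $p>\deg(f)$, where $\deg(f)$ is the total degree of $f$. Let $\alpha$ be a new indeterminate, let $\overline{k(\alpha,t)}$ be an algebraic closure of the field of rational functions $k(\alpha,t)$, and regard $\overline k$ as a subfield of $\overline{k(\alpha,t)}$ through any embedding over $k$. Then $f(t+\alpha x,x)$, viewed as a polynomial in the single variable $x$, is non-constant and indecomposable in $\overline{k(\alpha,t)}[x]$. -/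

import Mathlib

noncomputable section

/-- A polynomial in one variable over a field is *decomposable* if it is non-constant and equal to
`u(g(x))` with `u` and `g` both of degree at least `2`. -/
def IsDecomposable₁ {F : Type*} [Field F] (f : Polynomial F) : Prop :=
  0 < f.natDegree ∧
    ∃ u g : Polynomial F, 2 ≤ u.natDegree ∧ 2 ≤ g.natDegree ∧ f = u.comp g

/-- A polynomial in one variable is *indecomposable* if it is non-constant and not decomposable. -/
def IsIndecomposable₁ {F : Type*} [Field F] (f : Polynomial F) : Prop :=
  0 < f.natDegree ∧ ¬ IsDecomposable₁ f

/-- A polynomial in two variables over a field is *decomposable* if it is non-constant and equal to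
`u(g)` with `u` a polynomial in one variable of degree at least `2` and `g` a polynomial in the
two variables (of any degree). -/
def IsDecomposable₂ {F : Type*} [Field F] (f : MvPolynomial (Fin 2) F) : Prop :=
  0 < f.totalDegree ∧
    ∃ (u : Polynomial F) (g : MvPolynomial (Fin 2) F),
      2 ≤ u.natDegree ∧ f = Polynomial.aeval g u

/-- A polynomial in two variables is *indecomposable* if it is non-constant and
not decomposable. -/
def IsIndecomposable₂ {F : Type*} [Field F] (f : MvPolynomial (Fin 2) F) : Prop :=
  0 < f.totalDegree ∧ ¬ IsDecomposable₂ f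

/-- The field `k(α, t)` of rational functions in two indeterminates over `k`. -/
abbrev FunField (k : Type*) [Field k] : Type _ := FractionRing (MvPolynomial (Fin 2) k)

/-- The indeterminate `α`, as an element of the algebraic closure of `k(α, t)`. -/
def alphaVar (k : Type*) [Field k] : AlgebraicClosure (FunField k) :=
  algebraMap (FunField k) (AlgebraicClosure (FunField k))
    (algebraMap (MvPolynomial (Fin 2) k) (FunField k) (MvPolynomial.X 0))

/-- The indeterminate `t`, as an element of the algebraic closure of `k(α, t)`. -/
def tVar (k : Type*) [Field k] : AlgebraicClosure (FunField k) :=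
  algebraMap (FunField k) (AlgebraicClosure (FunField k))
    (algebraMap (MvPolynomial (Fin 2) k) (FunField k) (MvPolynomial.X 1))

/-- For `f = f(t, x)` over the algebraic closure of `k` (with `t = X 0` and `x = X 1`), the
polynomial `f(t + α x, x)` in the single variable `x` over the algebraic closure of `k(α, t)`;
the coefficients of `f` are transported by a `k`-embedding `ι`. -/
def shear {k : Type*} [Field k]
    (ι : AlgebraicClosure k →ₐ[k] AlgebraicClosure (FunField k))
    (f : MvPolynomial (Fin 2) (AlgebraicClosure k)) :
    Polynomial (AlgebraicClosure (FunField k)) :=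
  MvPolynomial.eval₂ (Polynomial.C.comp ι.toRingHom)
    ![Polynomial.C (tVar k) + Polynomial.C (alphaVar k) * Polynomial.X, Polynomial.X] f

end

/-! Let d be the total degree of f, K the algebraic closure of k, and suppose F = f(t + αx, x) =
u(g) with m = deg u ≥ 2 and n = deg g ≥ 2. The coefficient of x^d in F is P(α), where P is the
leading form of f. Choose a₀ in K with P(a₀) ≠ 0 and expand α = a₀ + s: then P(α) is a unit of K⟦s⟧,
and `exists_ringHom_extending` carries the decomposition to an algebraic closure of the fraction
field of K⟦s⟧[t].

Make g monic and the second coefficient of u zero. Solving for the coefficients then divides only by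
m and P(α), so they all lie in K⟦s⟧[t], those of u with degree at most d in t
(`exists_integral_decomposition`).

Now F is killed by ∂_s - x∂_t. By the chain rule u'(g)(g_s - x g_t) = x u_t(g) - u_s(g), and
comparing degrees in x modulo n forces u_t = 0 (`Polynomial.onCoeffs_eq_zero_of_comp`). As p = 0 or
p > d, u does not involve t. At s = 0 this reads f(t + a₀x, x) = u₀(g₀) with u₀ over K, and undoing
the shear decomposes f. -/

open Polynomial

/-! ### Derivations acting on coefficients, and their chain rule. -/

section CoeffDerivation

variable {R A : Type*} [CommRing R] [CommRing A] [Algebra R A]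

/-- The derivation of `A[X]` that applies a derivation of `A` to every coefficient. -/
noncomputable def Derivation.onCoeffs (D : Derivation R A A) : Derivation R A[X] A[X] :=
  (PolynomialModule.equivPolynomialSelf (R := A)).toLinearMap.compDer D.mapCoeffs

theorem Derivation.onCoeffs_monomial (D : Derivation R A A) (n : ℕ) (a : A) :
    D.onCoeffs (monomial n a) = monomial n (D a) := by
  simp [Derivation.onCoeffs]

theorem Derivation.coeff_onCoeffs (D : Derivation R A A) (p : A[X]) (i : ℕ) :
    (D.onCoeffs p).coeff i = D (p.coeff i) := by
  induction p using Polynomial.induction_on' with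
  | add p q hp hq => simp [hp, hq]
  | monomial n a =>
    rw [D.onCoeffs_monomial, coeff_monomial, coeff_monomial]
    split_ifs <;> simp

theorem Derivation.onCoeffs_C (D : Derivation R A A) (a : A) :
    D.onCoeffs (C a) = C (D a) := D.onCoeffs_monomial 0 a

theorem Derivation.onCoeffs_X (D : Derivation R A A) : D.onCoeffs X = 0 := by
  rw [← monomial_one_one_eq_X, D.onCoeffs_monomial]; simp

theorem Derivation.onCoeffs_comp (D : Derivation R A A) (u g : A[X]) :
    D.onCoeffs (u.comp g) =
      (D.onCoeffs u).comp g + (derivative u).comp g * D.onCoeffs g := by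
  induction u using Polynomial.induction_on' with
  | add p q hp hq => simp only [add_comp, map_add, hp, hq]; ring
  | monomial n a =>
    rw [← C_mul_X_pow_eq_monomial]
    simp only [mul_comp, C_comp, pow_comp, X_comp, Derivation.leibniz, Derivation.leibniz_pow,
      D.onCoeffs_C, D.onCoeffs_X, derivative_C_mul, derivative_X_pow, smul_eq_mul, add_comp,
      zero_comp, mul_zero, smul_zero, nsmul_eq_mul]
    rw [C_eq_natCast]
    ring

end CoeffDerivation

/-! ### Degrees modulo deg g: the outer polynomial does not depend on t. -/

section DegreeArguments

variable {R A : Type*} [CommRing R] [CommRing A] [IsDomain A] [Algebra R A]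

/-- Nonzero polynomials in `g` have degree divisible by the degree of `g`, so `x` is not a quotient
of two of them. -/
theorem Polynomial.eq_zero_of_X_mul_comp_eq_comp {g P Q : A[X]} (hg : 2 ≤ g.natDegree)
    (h : X * P.comp g = Q.comp g) : P = 0 := by
  by_contra hP
  have hPg : P.comp g ≠ 0 := fun h0 => by
    rcases comp_eq_zero_iff.1 h0 with h1 | ⟨-, h1⟩
    · exact hP h1
    · rw [h1, natDegree_C] at hg; omega
  have := congrArg natDegree h
  rw [natDegree_X_mul hPg, natDegree_comp, natDegree_comp] at this
  have h1 : (P.natDegree * g.natDegree + 1) % g.natDegree = 0 := by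
    rw [this, Nat.mul_mod_left]
  rw [Nat.add_mod, Nat.mul_mod_left, zero_add, Nat.mod_mod, Nat.mod_eq_of_lt (by omega)] at h1
  omega

/-- If `u(g)` is killed by the derivation `Ds - x Dt` of `A[x]`, and the two leading coefficients
of `u` are killed by `Dt`, then all of them are. -/
theorem Polynomial.onCoeffs_eq_zero_of_comp (Ds Dt : Derivation R A A) {u g : A[X]}
    (hu : 2 ≤ u.natDegree) (hg : 2 ≤ g.natDegree) (hgm : g.Monic)
    (hm : (u.natDegree : A) ≠ 0) (hlead : Dt u.leadingCoeff = 0)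
    (hnext : Dt (u.coeff (u.natDegree - 1)) = 0)
    (h : Ds.onCoeffs (u.comp g) - X * Dt.onCoeffs (u.comp g) = 0) :
    Dt.onCoeffs u = 0 := by
  set m := u.natDegree with hmdef
  set n := g.natDegree with hndef
  set ut := Dt.onCoeffs u with hut
  set δ := Ds.onCoeffs g - X * Dt.onCoeffs g with hδ
  have hchain : (derivative u).comp g * δ = X * ut.comp g - (Ds.onCoeffs u).comp g := by
    rw [Ds.onCoeffs_comp, Dt.onCoeffs_comp] at h
    rw [hδ]; linear_combination h
  -- The factor X could raise the degree to n + 1, but g is monic and derivations kill 1.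
  have hδn : δ.natDegree ≤ n := by
    rw [natDegree_le_iff_coeff_eq_zero]
    intro N hN
    obtain ⟨N, rfl⟩ : ∃ M, N = M + 1 := ⟨N - 1, by omega⟩
    rw [hδ, coeff_sub, coeff_X_mul, Ds.coeff_onCoeffs, Dt.coeff_onCoeffs,
      coeff_eq_zero_of_natDegree_lt hN, map_zero, zero_sub, neg_eq_zero]
    rcases eq_or_lt_of_le (Nat.lt_succ_iff.1 hN) with h1 | h1
    · rw [← h1, hndef, hgm.coeff_natDegree, Derivation.map_one_eq_zero]
    · rw [coeff_eq_zero_of_natDegree_lt h1, map_zero]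
  -- The quotient part a·g of δ contributes a·g·u'(g), a polynomial in g, which is absorbed into
  -- `w`; only the remainder r is left to control.
  obtain ⟨a, ha⟩ : ∃ a, δ /ₘ g = C a := by
    refine ⟨_, eq_C_of_natDegree_le_zero ?_⟩
    rw [natDegree_divByMonic _ hgm]; omega
  have hdiv : δ = δ %ₘ g + g * C a := by rw [← ha, modByMonic_add_div]
  set r := δ %ₘ g with hr
  have hrn : r.natDegree < n := natDegree_modByMonic_lt _ hgm (by rintro rfl; simp [hndef] at hg)
  set w := - Ds.onCoeffs u - C a * X * derivative u with hw
  have hmain : (derivative u).comp g * r = X * ut.comp g + w.comp g := by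
    rw [hw, sub_comp, mul_comp, mul_comp, C_comp, X_comp, neg_comp]
    rw [hdiv] at hchain
    linear_combination hchain
  have hutdeg : ut.natDegree ≤ m - 2 := by
    rw [natDegree_le_iff_coeff_eq_zero]
    intro N hN
    rw [hut, Dt.coeff_onCoeffs]
    rcases lt_trichotomy N (m - 1) with h1 | h1 | h1
    · omega
    · rw [h1, hnext]
    · rcases eq_or_lt_of_le (show m ≤ N by omega) with h2 | h2
      · rw [← h2]; exact hlead
      · rw [coeff_eq_zero_of_natDegree_lt h2, map_zero]
  have hu0 : u ≠ 0 := by rintro rfl; simp [hmdef] at hu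
  have hu'c : (derivative u).coeff (m - 1) ≠ 0 := by
    rw [coeff_derivative, Nat.sub_add_cancel (by omega)]
    refine mul_ne_zero (leadingCoeff_ne_zero.2 hu0) ?_
    rw [show ((m - 1 : ℕ) : A) + 1 = ((m - 1 + 1 : ℕ) : A) by push_cast; rfl,
      Nat.sub_add_cancel (by omega)]
    exact hm
  have hu' : (derivative u).natDegree = m - 1 :=
    le_antisymm (natDegree_derivative_le u) (le_natDegree_of_ne_zero hu'c)
  have hu'0 : derivative u ≠ 0 := fun h0 => by simp [h0] at hu'c
  have hu'g0 : (derivative u).comp g ≠ 0 := fun h0 => by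
    rcases comp_eq_zero_iff.1 h0 with h1 | ⟨-, h1⟩
    · exact hu'0 h1
    · rw [hndef, h1, natDegree_C] at hg; omega
  -- The term x·u_t(g) has degree at most (m - 2)n + 1, too small to matter, so w(g) has degree (m -
  -- 1)n + deg r. This is a multiple of n, while deg r < n.
  have hr0 : r.natDegree = 0 := by
    by_contra hr1
    have hr2 : r ≠ 0 := by rintro h0; simp [h0] at hr1
    have hl : ((derivative u).comp g * r).natDegree = (m - 1) * n + r.natDegree := by
      rw [natDegree_mul hu'g0 hr2, natDegree_comp, hu']
    have hx : (X * ut.comp g).natDegree < ((derivative u).comp g * r).natDegree := by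
      rw [hl]
      refine lt_of_le_of_lt natDegree_mul_le ?_
      rw [natDegree_X, natDegree_comp, ← hndef]
      have h1 : ut.natDegree * n ≤ (m - 2) * n := Nat.mul_le_mul_right _ hutdeg
      have h2 : (m - 1) * n = (m - 2) * n + n := by
        rw [show m - 1 = m - 2 + 1 by omega, add_mul, one_mul]
      omega
    have hwd : (w.comp g).natDegree = (m - 1) * n + r.natDegree := by
      rw [← hl, show w.comp g = (derivative u).comp g * r - X * ut.comp g by
        rw [hmain]; ring, natDegree_sub_eq_left_of_natDegree_lt hx]
    rw [natDegree_comp] at hwd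
    have h1 : ((m - 1) * n + r.natDegree) % n = 0 := by rw [← hwd, Nat.mul_mod_left]
    rw [Nat.add_mod, Nat.mul_mod_left, zero_add, Nat.mod_mod, Nat.mod_eq_of_lt hrn] at h1
    exact hr1 h1
  obtain ⟨b, hb⟩ : ∃ b, r = C b := ⟨_, eq_C_of_natDegree_le_zero hr0.le⟩
  refine eq_zero_of_X_mul_comp_eq_comp (Q := C b * derivative u - w) hg ?_
  rw [sub_comp, mul_comp, C_comp, ← hb]
  linear_combination -hmain

end DegreeArguments

/-! ### Weights of coefficients, and their inheritance by the factors of a composition. -/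

section Weighted

variable {E : Type*} [CommRing E]

/-- For a family `W` of additive subgroups of the coefficient ring, `P` has weight `N` if its
degree is at most `N` and the coefficient of `x ^ (N - j)` lies in `W j`. -/
def Polynomial.HasWeight (W : ℕ → AddSubgroup E) (N : ℕ) (P : E[X]) : Prop :=
  P.natDegree ≤ N ∧ ∀ i j, i + j = N → P.coeff i ∈ W j

namespace Polynomial.HasWeight

variable {W : ℕ → AddSubgroup E}

theorem zero (N : ℕ) : HasWeight W N 0 := ⟨by simp, fun i j _ => by simp [(W j).zero_mem]⟩

theorem add {N : ℕ} {P Q : E[X]} (hP : HasWeight W N P) (hQ : HasWeight W N Q) :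
    HasWeight W N (P + Q) :=
  ⟨(natDegree_add_le _ _).trans (max_le hP.1 hQ.1), fun i j h => by
    rw [coeff_add]; exact (W j).add_mem (hP.2 i j h) (hQ.2 i j h)⟩

theorem sub {N : ℕ} {P Q : E[X]} (hP : HasWeight W N P) (hQ : HasWeight W N Q) :
    HasWeight W N (P - Q) :=
  ⟨(natDegree_sub_le _ _).trans (max_le hP.1 hQ.1), fun i j h => by
    rw [coeff_sub]; exact (W j).sub_mem (hP.2 i j h) (hQ.2 i j h)⟩

theorem sum {ι : Type*} {N : ℕ} (s : Finset ι) {P : ι → E[X]}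
    (h : ∀ i ∈ s, HasWeight W N (P i)) : HasWeight W N (∑ i ∈ s, P i) := by
  classical
  induction s using Finset.induction_on with
  | empty => simpa using HasWeight.zero N
  | insert a s ha ih =>
    rw [Finset.sum_insert ha]
    exact (h a (by simp)).add (ih fun i hi => h i (by simp [hi]))

theorem monomial {N i j : ℕ} (hij : i + j = N) {a : E} (ha : a ∈ W j) :
    HasWeight W N (Polynomial.monomial i a) := by
  refine ⟨(natDegree_monomial_le a).trans (by omega), fun i' j' h => ?_⟩
  rw [coeff_monomial]
  split_ifs with h1
  · obtain rfl : j = j' := by omega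
    exact ha
  · exact (W j').zero_mem

theorem mono (hW : Monotone W) {M N : ℕ} (hMN : M ≤ N) {P : E[X]} (hP : HasWeight W M P) :
    HasWeight W N P := by
  refine ⟨hP.1.trans hMN, fun i j h => ?_⟩
  by_cases hi : i ≤ M
  · exact hW (show M - i ≤ j by omega) (hP.2 i (M - i) (by omega))
  · rw [coeff_eq_zero_of_natDegree_lt (lt_of_le_of_lt hP.1 (by omega))]
    exact (W j).zero_mem

theorem mul (hmul : ∀ i j a b, a ∈ W i → b ∈ W j → a * b ∈ W (i + j)) {M N : ℕ} {P Q : E[X]}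
    (hP : HasWeight W M P) (hQ : HasWeight W N Q) : HasWeight W (M + N) (P * Q) := by
  refine ⟨natDegree_mul_le.trans (add_le_add hP.1 hQ.1), fun i j h => ?_⟩
  rw [coeff_mul]
  refine (W j).sum_mem fun x hx => ?_
  rw [Finset.HasAntidiagonal.mem_antidiagonal] at hx
  by_cases h1 : x.1 ≤ M
  · by_cases h2 : x.2 ≤ N
    · obtain rfl : j = (M - x.1) + (N - x.2) := by omega
      exact hmul _ _ _ _ (hP.2 _ _ (by omega)) (hQ.2 _ _ (by omega))
    · rw [coeff_eq_zero_of_natDegree_lt (lt_of_le_of_lt hQ.1 (not_le.1 h2)), mul_zero]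
      exact (W j).zero_mem
  · rw [coeff_eq_zero_of_natDegree_lt (lt_of_le_of_lt hP.1 (not_le.1 h1)), zero_mul]
    exact (W j).zero_mem

theorem pow (hone : 1 ∈ W 0) (hmul : ∀ i j a b, a ∈ W i → b ∈ W j → a * b ∈ W (i + j))
    {N : ℕ} {P : E[X]} (hP : HasWeight W N P) (m : ℕ) : HasWeight W (m * N) (P ^ m) := by
  induction m with
  | zero => simpa using HasWeight.monomial (W := W) (i := 0) (j := 0) rfl hone
  | succ m ih => rw [pow_succ, add_mul, one_mul]; exact ih.mul hmul hP

end Polynomial.HasWeight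

/-- The leading coefficients of the difference of two `m`-th powers. -/
theorem Polynomial.coeff_pow_sub_pow {g h : E[X]} {n k m : ℕ} (hg : g.natDegree ≤ n)
    (hh : h.natDegree ≤ n) (hgn : g.coeff n = 1) (hhn : h.coeff n = 1)
    (hk : (g - h).natDegree ≤ k) :
    (g ^ m - h ^ m).coeff ((m - 1) * n + k) = m * (g - h).coeff k := by
  rw [← geom_sum₂_mul g h m, coeff_mul_add_eq_of_natDegree_le _ hk]
  · congr 1
    rw [finsetSum_coeff, Finset.sum_congr rfl (g := fun _ => 1)]
    · simp
    · intro i hi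
      rw [Finset.mem_range] at hi
      rw [show (m - 1) * n = i * n + (m - 1 - i) * n by rw [← add_mul]; congr 1; omega,
        coeff_mul_add_eq_of_natDegree_le (natDegree_pow_le_of_le i hg)
          (natDegree_pow_le_of_le (m - 1 - i) hh),
        coeff_pow_of_natDegree_le hg, coeff_pow_of_natDegree_le hh, hgn, hhn]
      simp
  · refine natDegree_sum_le_of_forall_le _ _ fun i hi => ?_
    rw [Finset.mem_range] at hi
    refine natDegree_mul_le.trans ((add_le_add (natDegree_pow_le_of_le i hg)
      (natDegree_pow_le_of_le (m - 1 - i) hh)).trans (le_of_eq ?_))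
    rw [← add_mul]; congr 1; omega

/-- The inner polynomial of a normalised decomposition inherits the weights. -/
theorem Polynomial.HasWeight.of_comp_inner {W : ℕ → AddSubgroup E} (hone : 1 ∈ W 0)
    (hmul : ∀ i j a b, a ∈ W i → b ∈ W j → a * b ∈ W (i + j)) {u g : E[X]} (hu : u.Monic)
    (hg : g.Monic) (hm : 2 ≤ u.natDegree)
    (hnext : u.coeff (u.natDegree - 1) = 0) {v : E} (hv : v ∈ W 0) (hvm : v * u.natDegree = 1)
    (hF : HasWeight W (u.natDegree * g.natDegree) (u.comp g)) :
    HasWeight W g.natDegree g := by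
  set m := u.natDegree with hmdef
  set n := g.natDegree with hndef
  have hmn : m * n = (m - 1) * n + n := by
    rw [← Nat.succ_mul]; congr 1; omega
  have hmn' : (m - 1) * n = (m - 2) * n + n := by
    rw [← Nat.succ_mul]; congr 1; omega
  have hlow : (u.comp g - g ^ m).natDegree ≤ (m - 2) * n := by
    have : u.comp g - g ^ m = (u - X ^ m).comp g := by simp
    rw [this]
    refine natDegree_comp_le.trans (Nat.mul_le_mul_right _ ?_)
    rw [natDegree_le_iff_coeff_eq_zero]
    intro N hN
    rw [coeff_sub, coeff_X_pow]
    rcases lt_trichotomy N (m - 1) with h1 | h1 | h1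
    · omega
    · rw [h1, hnext, if_neg (by omega), sub_zero]
    · rcases eq_or_lt_of_le (show m ≤ N by omega) with h2 | h2
      · rw [← h2, if_pos rfl, hmdef, hu.coeff_natDegree, sub_self]
      · rw [coeff_eq_zero_of_natDegree_lt h2, if_neg (by omega), sub_zero]
  -- Coefficients are recovered from the top down. With h the part of g already known, m·g_{n-j} is
  -- a coefficient of g^m - h^m. There g^m may be replaced by u(g), since the vanishing second
  -- coefficient of u makes the two agree above degree (m - 2)n.
  have key : ∀ j, j ≤ n → g.coeff (n - j) ∈ W j := by
    intro j
    induction j using Nat.strong_induction_on with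
    | _ j ih =>
      intro hj
      rcases Nat.eq_zero_or_pos j with rfl | hj0
      · rw [Nat.sub_zero, hndef, hg.coeff_natDegree]; exact hone
      set h : E[X] := ∑ i ∈ Finset.Ioc (n - j) n, Polynomial.monomial i (g.coeff i) with hh
      have hcoeff : ∀ k, h.coeff k = if k ∈ Finset.Ioc (n - j) n then g.coeff k else 0 := by
        intro k
        simp only [hh, finsetSum_coeff, coeff_monomial, Finset.sum_ite_eq']
      have hw : HasWeight W n h := by
        refine HasWeight.sum _ fun i hi => ?_
        rw [Finset.mem_Ioc] at hi
        refine HasWeight.monomial (j := n - i) (by omega) ?_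
        have := ih (n - i) (by omega) (by omega)
        rwa [show n - (n - i) = i by omega] at this
      have hdiff : (g - h).natDegree ≤ n - j := by
        rw [natDegree_le_iff_coeff_eq_zero]
        intro N hN
        rw [coeff_sub, hcoeff]
        split_ifs with h1
        · exact sub_self _
        · rw [Finset.mem_Ioc] at h1
          rw [coeff_eq_zero_of_natDegree_lt (by omega), sub_zero]
      have hgn : g.coeff n = 1 := hg.coeff_natDegree
      have hhn : h.coeff n = 1 := by
        rw [hcoeff, if_pos (Finset.mem_Ioc.2 ⟨by omega, le_rfl⟩), hgn]
      have e := coeff_pow_sub_pow (m := m) hndef.symm.le hw.1 hgn hhn hdiff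
      rw [coeff_sub, coeff_sub, hcoeff, if_neg (by rw [Finset.mem_Ioc]; omega), sub_zero] at e
      have e2 : (g ^ m).coeff ((m - 1) * n + (n - j)) =
          (u.comp g).coeff ((m - 1) * n + (n - j)) := by
        have := coeff_eq_zero_of_natDegree_lt
          (lt_of_le_of_lt hlow (show (m - 2) * n < (m - 1) * n + (n - j) by omega))
        rw [coeff_sub, sub_eq_zero] at this
        exact this.symm
      have e3 : (m : E) * g.coeff (n - j) ∈ W j := by
        rw [← e, e2]
        exact (W j).sub_mem (hF.2 _ _ (by omega)) ((hw.pow hone hmul m).2 _ _ (by omega))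
      have e4 := hmul _ _ _ _ hv e3
      rwa [← mul_assoc, hvm, one_mul, zero_add] at e4
  refine ⟨le_rfl, fun i j h => ?_⟩
  have := key j (by omega)
  rwa [show n - j = i by omega] at this

/-- The outer polynomial of a decomposition inherits the weights from the inner one. -/
theorem Polynomial.HasWeight.of_comp_outer {W : ℕ → AddSubgroup E} (hone : 1 ∈ W 0)
    (hmul : ∀ i j a b, a ∈ W i → b ∈ W j → a * b ∈ W (i + j)) {g : E[X]}
    (hg : g.Monic) (hn : 0 < g.natDegree) (hgw : HasWeight W g.natDegree g) {m : ℕ} :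
    ∀ (M : ℕ) (u : E[X]), M ≤ m → u.natDegree ≤ M → HasWeight W (m * g.natDegree) (u.comp g) →
      ∀ i, i ≤ M → u.coeff i ∈ W ((m - i) * g.natDegree) := by
  intro M
  induction M with
  | zero =>
    intro u _ hu hw i hi
    obtain rfl : i = 0 := by omega
    obtain ⟨a, rfl⟩ : ∃ a, u = C a := ⟨_, eq_C_of_natDegree_le_zero hu⟩
    rw [C_comp] at hw
    exact hw.2 0 _ (by simp)
  | succ M ih =>
    intro u hM hu hw i hi
    set n := g.natDegree with hndef
    set a := u.coeff (M + 1) with ha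
    have hu' : (u - C a * X ^ (M + 1)).natDegree ≤ M := by
      rw [natDegree_le_iff_coeff_eq_zero]
      intro N hN
      rw [coeff_sub, coeff_C_mul_X_pow]
      split_ifs with h1
      · rw [h1, ha, sub_self]
      · rw [coeff_eq_zero_of_natDegree_lt (by omega), sub_zero]
    have hsplit : u.comp g = (u - C a * X ^ (M + 1)).comp g + C a * g ^ (M + 1) := by simp
    have hmM : m * n = (M + 1) * n + (m - (M + 1)) * n := by
      rw [← add_mul]; congr 1; omega
    -- As g is monic, the top coefficient of u is itself a coefficient of u(g); subtracting its term
    -- preserves the weight and lowers the degree.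
    have haW : a ∈ W ((m - (M + 1)) * n) := by
      have h1 : (u.comp g).coeff ((M + 1) * n) = a := by
        rw [hsplit, coeff_add, coeff_C_mul, coeff_pow_of_natDegree_le hndef.symm.le,
          hg.coeff_natDegree, one_pow, mul_one, coeff_eq_zero_of_natDegree_lt, zero_add]
        refine lt_of_le_of_lt (natDegree_comp_le.trans (Nat.mul_le_mul_right _ hu')) ?_
        exact Nat.mul_lt_mul_of_pos_right (Nat.lt_succ_self M) hn
      rw [← h1]
      exact hw.2 _ _ hmM.symm
    have hterm : HasWeight W (m * n) (C a * g ^ (M + 1)) := by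
      have := (HasWeight.monomial (W := W) (i := 0) (zero_add _) haW).mul hmul
        (hgw.pow hone hmul (M + 1))
      rwa [monomial_zero_left, ← add_comm, ← hmM] at this
    rcases eq_or_lt_of_le hi with rfl | hi
    · exact haW
    · have := ih (u - C a * X ^ (M + 1)) (by omega) hu'
        (by rw [eq_sub_of_add_eq hsplit.symm]; exact hw.sub hterm) i (by omega)
      rwa [coeff_sub, coeff_C_mul_X_pow, if_neg (by omega), sub_zero] at this

end Weighted

/-! ### Normalising a decomposition over a field. -/

section Normalise

variable {E : Type*} [Field E]

theorem Polynomial.coeff_taylor_natDegree_sub_one {u : E[X]} (hu : u.Monic)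
    (hm : 0 < u.natDegree) (r : E) :
    (taylor r u).coeff (u.natDegree - 1) = u.coeff (u.natDegree - 1) + u.natDegree * r := by
  rw [taylor_coeff, eval_eq_sum_range' (n := 2), Finset.sum_range_succ, Finset.sum_range_one,
    hasseDeriv_coeff, hasseDeriv_coeff, zero_add, Nat.add_sub_cancel' hm, hu.coeff_natDegree,
    Nat.choose_self, Nat.choose_symm hm]
  · simp
  · exact lt_of_le_of_lt (natDegree_hasseDeriv_le _ _) (by omega)

/-- A decomposition over a field can be normalised: both factors are monic and the outer one has
vanishing second coefficient. -/
theorem Polynomial.exists_normalised_comp {u g : E[X]} (hu : 0 < u.natDegree)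
    (hg : 0 < g.natDegree) (hm : (u.natDegree : E) ≠ 0) :
    ∃ u' g' : E[X], u'.Monic ∧ g'.Monic ∧ u'.natDegree = u.natDegree ∧
      g'.natDegree = g.natDegree ∧ u'.coeff (u'.natDegree - 1) = 0 ∧
      u.comp g = C (u.comp g).leadingCoeff * u'.comp g' := by
  have hg0 : g ≠ 0 := by rintro rfl; simp at hg
  have hu0 : u ≠ 0 := by rintro rfl; simp at hu
  set b := g.leadingCoeff with hb
  have hb0 : b ≠ 0 := leadingCoeff_ne_zero.2 hg0
  set c := (u.comp g).leadingCoeff with hc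
  have hc' : c = u.leadingCoeff * b ^ u.natDegree := leadingCoeff_comp hg.ne'
  have hc0 : c ≠ 0 := by
    rw [hc']; exact mul_ne_zero (leadingCoeff_ne_zero.2 hu0) (pow_ne_zero _ hb0)
  set w := C c⁻¹ * u.comp (C b * X) with hw
  have hwd : w.natDegree = u.natDegree := by
    rw [hw, natDegree_C_mul (inv_ne_zero hc0), natDegree_comp, natDegree_C_mul hb0, natDegree_X,
      mul_one]
  have hwm : w.Monic := by
    rw [Monic, hw, leadingCoeff_mul, leadingCoeff_C, leadingCoeff_comp, leadingCoeff_mul,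
      leadingCoeff_C, leadingCoeff_X, mul_one, ← hc', inv_mul_cancel₀ hc0]
    rw [natDegree_C_mul hb0, natDegree_X]; exact one_ne_zero
  -- The translation that cancels the second coefficient; it needs the degree to be invertible.
  set r := - (w.coeff (w.natDegree - 1) / w.natDegree) with hr
  refine ⟨taylor r w, C b⁻¹ * g - C r, ?_, ?_, ?_, ?_, ?_, ?_⟩
  · rw [Monic, leadingCoeff, natDegree_taylor, taylor_apply]
    have h1 : (w.comp (X + C r)).natDegree = w.natDegree := by
      rw [natDegree_comp, natDegree_X_add_C, mul_one]
    rw [← h1, coeff_natDegree, leadingCoeff_comp (by rw [natDegree_X_add_C]; exact one_ne_zero),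
      leadingCoeff_X_add_C, one_pow, mul_one]
    exact hwm
  · have h1 : (C b⁻¹ * g).Monic := by
      rw [Monic, leadingCoeff_mul, leadingCoeff_C, ← hb, inv_mul_cancel₀ hb0]
    rw [sub_eq_add_neg, ← C_neg]
    refine h1.add_of_left (lt_of_le_of_lt degree_C_le ?_)
    rw [← natDegree_pos_iff_degree_pos, natDegree_C_mul (inv_ne_zero hb0)]
    exact hg
  · rw [natDegree_taylor, hwd]
  · rw [natDegree_sub_C, natDegree_C_mul (inv_ne_zero hb0)]
  · rw [natDegree_taylor, coeff_taylor_natDegree_sub_one hwm (by omega), hr]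
    have : (w.natDegree : E) ≠ 0 := by rwa [hwd]
    field_simp
    ring
  · rw [taylor_apply, comp_assoc, add_comp, X_comp, C_comp, sub_add_cancel, hw, mul_comp, C_comp,
      comp_assoc, mul_comp, C_comp, X_comp, ← mul_assoc, ← mul_assoc, ← C_mul, ← C_mul,
      mul_inv_cancel₀ hc0, mul_inv_cancel₀ hb0, C_1, one_mul, one_mul]

end Normalise

/-! ### The shear: weights, leading coefficient, differential equation, inverse. -/

section ShearHom

variable {K A : Type*} [Field K] [CommRing A]

/-- The substitution `f(t, x) ↦ f(t + a x, x)`, with coefficients transported along `φ`. -/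
noncomputable def shearHom (φ : K →+* A) (t a : A) : MvPolynomial (Fin 2) K →+* A[X] :=
  MvPolynomial.eval₂Hom (C.comp φ) ![C t + C a * X, X]

theorem shearHom_C (φ : K →+* A) (t a : A) (c : K) :
    shearHom φ t a (MvPolynomial.C c) = C (φ c) := by
  simp [shearHom]

theorem shearHom_X_zero (φ : K →+* A) (t a : A) :
    shearHom φ t a (MvPolynomial.X 0) = C t + C a * X := by
  simp [shearHom]

theorem shearHom_X_one (φ : K →+* A) (t a : A) :
    shearHom φ t a (MvPolynomial.X 1) = X := by
  simp [shearHom]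

theorem map_shearHom {B : Type*} [CommRing B] (ψ : A →+* B) (φ : K →+* A) (t a : A)
    (f : MvPolynomial (Fin 2) K) :
    (shearHom φ t a f).map ψ = shearHom (ψ.comp φ) (ψ t) (ψ a) f := by
  have : (mapRingHom ψ).comp (shearHom φ t a) = shearHom (ψ.comp φ) (ψ t) (ψ a) := by
    refine MvPolynomial.ringHom_ext (fun c => ?_) (fun i => ?_)
    · simp [shearHom_C]
    · fin_cases i <;> simp [shearHom_X_zero, shearHom_X_one]
  exact congrArg (fun h => h f) this

theorem shearHom_eq_sum (φ : K →+* A) (t a : A) (f : MvPolynomial (Fin 2) K) :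
    shearHom φ t a f =
      ∑ s ∈ f.support, C (φ (f.coeff s)) * ((C t + C a * X) ^ s 0 * X ^ s 1) := by
  rw [shearHom, MvPolynomial.coe_eval₂Hom, MvPolynomial.eval₂_eq']
  simp [Fin.prod_univ_two]

theorem MvPolynomial.apply_zero_add_apply_one_le_totalDegree {f : MvPolynomial (Fin 2) K}
    {s : Fin 2 →₀ ℕ} (hs : s ∈ f.support) : s 0 + s 1 ≤ f.totalDegree := by
  have := MvPolynomial.le_totalDegree hs
  rwa [Finsupp.sum_fintype _ _ (fun _ => rfl), Fin.sum_univ_two] at this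

theorem hasWeight_shearHom {W : ℕ → AddSubgroup A} (hW : Monotone W) (hone : 1 ∈ W 0)
    (hmul : ∀ i j a b, a ∈ W i → b ∈ W j → a * b ∈ W (i + j)) {φ : K →+* A} {t a : A}
    (hφ : ∀ c, φ c ∈ W 0) (ht : t ∈ W 1) (ha : a ∈ W 0) (f : MvPolynomial (Fin 2) K) :
    HasWeight W f.totalDegree (shearHom φ t a f) := by
  rw [shearHom_eq_sum]
  refine HasWeight.sum _ fun s hs => ?_
  refine HasWeight.mono hW (MvPolynomial.apply_zero_add_apply_one_le_totalDegree hs) ?_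
  have h1 : HasWeight W 0 (C (φ (f.coeff s))) :=
    HasWeight.monomial (i := 0) (j := 0) rfl (hφ _)
  have hX : HasWeight W 1 (X : A[X]) := by
    rw [← monomial_one_one_eq_X]; exact HasWeight.monomial (j := 0) rfl hone
  have h2 : HasWeight W 1 (C t + C a * X) := by
    refine HasWeight.add (HasWeight.monomial (i := 0) (j := 1) rfl ht) ?_
    have := HasWeight.mul hmul (HasWeight.monomial (W := W) (i := 0) (j := 0) rfl ha) hX
    simpa using this
  have := h1.mul hmul ((h2.pow hone hmul (s 0)).mul hmul (hX.pow hone hmul (s 1)))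
  simpa using this

/-- The leading homogeneous form of `f(t, x)`, dehomogenised at `x = 1`. -/
noncomputable def leadingForm (f : MvPolynomial (Fin 2) K) : K[X] :=
  ∑ s ∈ f.support with s 0 + s 1 = f.totalDegree, monomial (s 0) (f.coeff s)

/-- Among monomials of top total degree the exponent of t determines that of x, so no cancellation
occurs on setting x = 1. -/
theorem leadingForm_ne_zero {f : MvPolynomial (Fin 2) K} (hf : 0 < f.totalDegree) :
    leadingForm f ≠ 0 := by
  obtain ⟨s, hs, hsd⟩ : ∃ s ∈ f.support, s 0 + s 1 = f.totalDegree := by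
    have hne : f.support.Nonempty := by
      rw [Finset.nonempty_iff_ne_empty]
      intro h
      rw [MvPolynomial.totalDegree, h] at hf
      simp at hf
    obtain ⟨s, hs, h⟩ := Finset.exists_mem_eq_sup f.support hne fun s => s.sum fun _ e => e
    refine ⟨s, hs, ?_⟩
    rw [MvPolynomial.totalDegree, h, Finsupp.sum_fintype _ _ (fun _ => rfl), Fin.sum_univ_two]
  intro h0
  have h1 : (leadingForm f).coeff (s 0) = f.coeff s := by
    rw [leadingForm, finsetSum_coeff, Finset.sum_eq_single s]
    · simp
    · intro r hr hrs
      rw [Finset.mem_filter] at hr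
      rw [coeff_monomial, if_neg]
      intro h
      refine hrs (Finsupp.ext fun i => ?_)
      fin_cases i
      · exact h
      · have := hr.2
        show r 1 = s 1
        omega
    · intro h
      exact absurd (Finset.mem_filter.2 ⟨hs, hsd⟩) h
  rw [h0, coeff_zero] at h1
  exact MvPolynomial.mem_support_iff.1 hs h1.symm

theorem coeff_shearHom_totalDegree (φ : K →+* A) (t a : A) (f : MvPolynomial (Fin 2) K) :
    (shearHom φ t a f).coeff f.totalDegree = (leadingForm f).eval₂ φ a := by
  rw [shearHom_eq_sum, finsetSum_coeff, leadingForm, eval₂_finsetSum, Finset.sum_filter]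
  refine Finset.sum_congr rfl fun s hs => ?_
  have hd : (C t + C a * X).natDegree ≤ 1 := by
    rw [add_comm]; exact natDegree_linear_le
  rw [coeff_C_mul]
  have hle := MvPolynomial.apply_zero_add_apply_one_le_totalDegree hs
  split_ifs with h
  · rw [← h, coeff_mul_X_pow, eval₂_monomial]
    have := coeff_pow_of_natDegree_le (m := s 0) hd
    rw [mul_one] at this
    rw [this]
    simp
  · rw [coeff_eq_zero_of_natDegree_lt, mul_zero]
    refine lt_of_le_of_lt natDegree_mul_le (lt_of_le_of_lt (add_le_add
      (natDegree_pow_le_of_le (s 0) hd) (natDegree_X_pow_le _)) ?_)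
    omega

/-- The operator Ds - x·Dt is a derivation that kills both generators t + ax and x, as well as the
constants. -/
theorem onCoeffs_shearHom [Algebra K A] (Ds Dt : Derivation K A A) {t a : A} (hst : Ds t = 0)
    (hsa : Ds a = 1) (htt : Dt t = 1) (hta : Dt a = 0) (f : MvPolynomial (Fin 2) K) :
    Ds.onCoeffs (shearHom (algebraMap K A) t a f) -
      X * Dt.onCoeffs (shearHom (algebraMap K A) t a f) = 0 := by
  induction f using MvPolynomial.induction_on with
  | C c => simp [shearHom_C, Derivation.onCoeffs_C]
  | add p q hp hq =>
    simp only [map_add]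
    linear_combination hp + hq
  | mul_X p i hp =>
    rw [map_mul, Derivation.leibniz, Derivation.leibniz]
    fin_cases i
    · simp only [Fin.zero_eta, shearHom_X_zero, map_add, Derivation.leibniz,
        Derivation.onCoeffs_C, Derivation.onCoeffs_X, smul_eq_mul, hst, hsa, htt, hta, map_zero,
        map_one]
      linear_combination (C t + C a * X) * hp
    · simp only [Fin.mk_one, shearHom_X_one, Derivation.onCoeffs_X, smul_eq_mul]
      linear_combination X * hp

/-- Undoing the shear `t ↦ t + a x`. -/
theorem unshear_shearHom (a : K) (f : MvPolynomial (Fin 2) K) :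
    eval₂RingHom (aeval (R := K) (MvPolynomial.X 0 - MvPolynomial.C a * MvPolynomial.X 1 :
      MvPolynomial (Fin 2) K)).toRingHom (MvPolynomial.X 1) (shearHom C X (C a) f) = f := by
  set η := eval₂RingHom (aeval (R := K) (MvPolynomial.X 0 - MvPolynomial.C a * MvPolynomial.X 1 :
      MvPolynomial (Fin 2) K)).toRingHom (MvPolynomial.X 1)
  have : η.comp (shearHom C X (C a)) = RingHom.id _ := by
    refine MvPolynomial.ringHom_ext (fun c => ?_) (fun i => ?_)
    · simp [shearHom_C, η, MvPolynomial.algebraMap_eq]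
    · fin_cases i <;> simp [shearHom_X_zero, shearHom_X_one, η, MvPolynomial.algebraMap_eq]
  exact congrArg (fun h => h f) this

end ShearHom

/-! ### From a decomposition of the sheared polynomial to one of f. -/

section Descent

theorem Polynomial.exists_map_eq_of_coeff {A E : Type*} [CommRing A] [CommRing E] (φ : A →+* E)
    {p : E[X]} (h : ∀ i, ∃ a, φ a = p.coeff i) : ∃ q : A[X], q.map φ = p := by
  have : p ∈ lifts φ := (lifts_iff_coeff_lifts p).2 fun i => h i
  exact (mem_lifts p).1 this

/-- The filtration by degree, pushed forward along a ring homomorphism. -/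
def degreeFiltration {S E : Type*} [CommRing S] [CommRing E] (φ : S[X] →+* E) (j : ℕ) :
    AddSubgroup E where
  carrier := {e | ∃ a : S[X], a.natDegree ≤ j ∧ φ a = e}
  zero_mem' := ⟨0, by simp⟩
  add_mem' := by
    rintro _ _ ⟨a, ha, rfl⟩ ⟨b, hb, rfl⟩
    exact ⟨a + b, (natDegree_add_le _ _).trans (max_le ha hb), map_add _ _ _⟩
  neg_mem' := by
    rintro _ ⟨a, ha, rfl⟩
    exact ⟨-a, by rwa [natDegree_neg], map_neg _ _⟩

section

variable {S E : Type*} [CommRing S] [CommRing E] (φ : S[X] →+* E)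

theorem mem_degreeFiltration {j : ℕ} {a : S[X]} (ha : a.natDegree ≤ j) :
    φ a ∈ degreeFiltration φ j := ⟨a, ha, rfl⟩

theorem degreeFiltration_mono : Monotone (degreeFiltration φ) := by
  rintro i j hij _ ⟨a, ha, rfl⟩
  exact ⟨a, ha.trans hij, rfl⟩

theorem one_mem_degreeFiltration : 1 ∈ degreeFiltration φ 0 := ⟨1, by simp⟩

theorem mul_mem_degreeFiltration (i j : ℕ) (a b : E) (ha : a ∈ degreeFiltration φ i)
    (hb : b ∈ degreeFiltration φ j) : a * b ∈ degreeFiltration φ (i + j) := by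
  obtain ⟨a, ha, rfl⟩ := ha
  obtain ⟨b, hb, rfl⟩ := hb
  exact ⟨a * b, natDegree_mul_le.trans (add_le_add ha hb), map_mul _ _ _⟩

end

theorem Polynomial.natDegree_eq_zero_of_derivative {S : Type*} [CommRing S] [IsDomain S] {d : ℕ}
    (hd : ∀ i, 0 < i → i ≤ d → (i : S) ≠ 0) {p : S[X]} (hp : p.natDegree ≤ d)
    (h : derivative p = 0) : p.natDegree = 0 := by
  by_contra h0
  have h1 := congrArg (fun q => q.coeff (p.natDegree - 1)) h
  simp only [coeff_derivative, coeff_zero] at h1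
  rw [← Nat.cast_add_one, Nat.sub_add_cancel (by omega)] at h1
  rcases mul_eq_zero.1 h1 with h2 | h2
  · rw [coeff_natDegree, leadingCoeff_eq_zero] at h2
    simp [h2] at h0
  · exact hd _ (by omega) hp h2

variable {K E : Type*} [Field K] [Field E]

/-- A decomposition of `f(t + (α₀ + s) x, x)` over an extension of `K⟦s⟧[t]` can be brought to the
form `u(g)` with `u` over `K⟦s⟧[t]` of controlled degree in `t`. -/
theorem exists_integral_decomposition {S : Type*} [CommRing S] [IsDomain S] [Algebra K S]
    {φ : S[X] →+* E} (hφ : Function.Injective φ) {f : MvPolynomial (Fin 2) K}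
    (hchar : ∀ i, 0 < i → i ≤ f.totalDegree → (i : K) ≠ 0) {a : S}
    (hunit : IsUnit (aeval a (leadingForm f))) {u g : E[X]} (hu : 2 ≤ u.natDegree)
    (hg : 2 ≤ g.natDegree)
    (h : u.comp g = shearHom (φ.comp (algebraMap K S[X])) (φ X) (φ (C a)) f) :
    ∃ u' g' : S[X][X], 2 ≤ u'.natDegree ∧ u'.natDegree ≤ f.totalDegree ∧ 2 ≤ g'.natDegree ∧
      g'.Monic ∧ u'.leadingCoeff = C (aeval a (leadingForm f)) ∧
      u'.coeff (u'.natDegree - 1) = 0 ∧ (∀ i, (u'.coeff i).natDegree ≤ f.totalDegree) ∧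
      u'.comp g' = shearHom (algebraMap K S[X]) X (C a) f := by
  set d := f.totalDegree with hd
  set W := degreeFiltration φ
  have hone := one_mem_degreeFiltration φ
  have hmul := mul_mem_degreeFiltration φ
  have hmono := degreeFiltration_mono φ
  have hW : HasWeight W d (u.comp g) := by
    rw [h]
    refine hasWeight_shearHom hmono hone hmul (fun c => mem_degreeFiltration φ ?_)
      (mem_degreeFiltration φ natDegree_X_le) (mem_degreeFiltration φ (natDegree_C a).le) f
    rw [Polynomial.algebraMap_apply, natDegree_C]
  obtain ⟨c, hc⟩ := hunit
  have hcoeff : (u.comp g).coeff d = φ (C (c : S)) := by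
    rw [h, coeff_shearHom_totalDegree, hc, aeval_def]
    exact (hom_eval₂ _ _ (φ.comp C) _).symm
  have hc0 : φ (C (c : S)) ≠ 0 := by
    rw [Ne, map_eq_zero_iff _ hφ, C_eq_zero]; exact c.ne_zero
  have hdeg : (u.comp g).natDegree = d :=
    le_antisymm hW.1 (le_natDegree_of_ne_zero (by rwa [hcoeff]))
  have hlead : (u.comp g).leadingCoeff = φ (C (c : S)) := by rw [leadingCoeff, hdeg, hcoeff]
  have hmn : u.natDegree * g.natDegree = d := by rw [← natDegree_comp, hdeg]
  have hmd : u.natDegree ≤ d := by rw [← hmn]; exact Nat.le_mul_of_pos_right _ (by omega)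
  have hmK : (u.natDegree : K) ≠ 0 := hchar _ (by omega) hmd
  set v := φ (algebraMap K S[X] (u.natDegree : K)⁻¹) with hv
  have hvm : v * (u.natDegree : E) = 1 := by
    rw [hv, ← map_natCast φ, ← map_natCast (algebraMap K S[X]), ← map_mul, ← map_mul,
      inv_mul_cancel₀ hmK, map_one, map_one]
  have hvW : v ∈ W 0 := mem_degreeFiltration φ (by rw [Polynomial.algebraMap_apply, natDegree_C])
  obtain ⟨u₁, g₁, hu₁, hg₁, hu₁d, hg₁d, hnext, hcomp⟩ :=
    exists_normalised_comp (u := u) (g := g) (by omega) (by omega) (right_ne_zero_of_mul_eq_one hvm)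
  rw [hlead] at hcomp
  -- Dividing by the leading coefficient costs no weight: it is a unit of S, so its inverse has
  -- degree 0 in t.
  have hW₁ : HasWeight W d (u₁.comp g₁) := by
    have h1 : u₁.comp g₁ = monomial 0 (φ (C ((c⁻¹ : Sˣ) : S))) * u.comp g := by
      rw [hcomp, monomial_zero_left, ← mul_assoc, ← C_mul, ← map_mul, ← C_mul, Units.inv_mul]
      simp
    rw [h1, ← zero_add d]
    exact HasWeight.mul hmul
      (HasWeight.monomial (zero_add 0) (mem_degreeFiltration φ (natDegree_C _).le)) hW
  rw [← hmn, ← hu₁d, ← hg₁d] at hW₁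
  have hgW := HasWeight.of_comp_inner hone hmul hu₁ hg₁ (by omega) hnext hvW
    (by rw [hu₁d]; exact hvm) hW₁
  have huW := HasWeight.of_comp_outer hone hmul hg₁ (by omega) hgW _ u₁ le_rfl le_rfl hW₁
  obtain ⟨g₂, hg₂⟩ := exists_map_eq_of_coeff φ (p := g₁) fun i => by
    by_cases hi : i ≤ g₁.natDegree
    · obtain ⟨b, -, hb⟩ := hgW.2 i (g₁.natDegree - i) (by omega)
      exact ⟨b, hb⟩
    · exact ⟨0, by rw [map_zero, coeff_eq_zero_of_natDegree_lt (by omega)]⟩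
  have hu₁c : ∀ i, ∃ b : S[X], b.natDegree ≤ d ∧ φ b = u₁.coeff i := fun i => by
    by_cases hi : i ≤ u₁.natDegree
    · obtain ⟨b, hb, hb'⟩ := huW i hi
      refine ⟨b, hb.trans ?_, hb'⟩
      rw [← hmn, ← hu₁d, ← hg₁d]
      exact Nat.mul_le_mul_right _ (Nat.sub_le _ _)
    · exact ⟨0, by simp, by rw [map_zero, coeff_eq_zero_of_natDegree_lt (by omega)]⟩
  obtain ⟨u₂, hu₂⟩ := exists_map_eq_of_coeff φ (p := u₁) fun i =>
    (hu₁c i).imp fun _ hb => hb.2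
  have hu₂d : u₂.natDegree = u.natDegree := by
    rw [← hu₁d, ← hu₂, natDegree_map_eq_of_injective hφ]
  have hu₂m : u₂.Monic := monic_of_injective hφ (by rwa [hu₂])
  have hCc : (C (c : S) : S[X]) ≠ 0 := C_ne_zero.2 c.ne_zero
  have hud : (C (C (c : S)) * u₂).natDegree = u.natDegree := by
    rw [natDegree_C_mul hCc, hu₂d]
  refine ⟨C (C (c : S)) * u₂, g₂, ?_, ?_, ?_, ?_, ?_, ?_, ?_, ?_⟩
  · rwa [hud]
  · rwa [hud]
  · rwa [← natDegree_map_eq_of_injective hφ, hg₂, hg₁d]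
  · exact monic_of_injective hφ (by rwa [hg₂])
  · rw [leadingCoeff_mul, leadingCoeff_C, hu₂m.leadingCoeff, mul_one, hc]
  · rw [hud, coeff_C_mul]
    have : φ (u₂.coeff (u.natDegree - 1)) = 0 := by
      rw [← coeff_map, hu₂, ← hu₁d, hnext]
    rw [(map_eq_zero_iff _ hφ).1 this, mul_zero]
  · intro i
    rw [coeff_C_mul]
    obtain ⟨b, hb, hb'⟩ := hu₁c i
    have : u₂.coeff i = b := hφ (by rw [hb', ← coeff_map, hu₂])
    rw [this]
    exact (natDegree_C_mul_le _ _).trans hb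
  · refine map_injective φ hφ ?_
    rw [map_shearHom, ← h, map_comp, Polynomial.map_mul, hu₂, hg₂, map_C, mul_comp, C_comp, hcomp]

theorem isDecomposable₂_of_unshear {f : MvPolynomial (Fin 2) K} (hf : 0 < f.totalDegree) {a : K}
    {u : K[X]} {g : K[X][X]} (hu : 2 ≤ u.natDegree)
    (h : shearHom C X (C a) f = (u.map C).comp g) : IsDecomposable₂ f := by
  set η := eval₂RingHom (aeval (R := K) (MvPolynomial.X 0 - MvPolynomial.C a * MvPolynomial.X 1 :
    MvPolynomial (Fin 2) K)).toRingHom (MvPolynomial.X 1) with hη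
  refine ⟨hf, u, η g, hu, ?_⟩
  have hC : (η.comp C).comp C = algebraMap K (MvPolynomial (Fin 2) K) := by
    ext1 x
    simp only [hη, RingHom.comp_apply, coe_eval₂RingHom, eval₂_C]
    exact aeval_C _ x
  conv_lhs => rw [← unshear_shearHom a f, ← hη, h, comp, eval₂_map, hom_eval₂, ← RingHom.comp_assoc,
    hC]
  rw [aeval_def]

/-- Once the outer polynomial is free of t, the specialisation s = 0 sends it to K[x]. Its degree
survives being at least 2 because its leading coefficient specialises to the leading form at a₀;
nothing is required of the degree of the inner polynomial. -/
theorem isDecomposable₂_of_shear_decomposition {φ : (PowerSeries K)[X] →+* E}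
    (hφ : Function.Injective φ) {f : MvPolynomial (Fin 2) K} (hf : 0 < f.totalDegree)
    (hchar : ∀ i, 0 < i → i ≤ f.totalDegree → (i : K) ≠ 0) {a₀ : K}
    (ha₀ : (leadingForm f).eval a₀ ≠ 0) {u g : E[X]} (hu : 2 ≤ u.natDegree)
    (hg : 2 ≤ g.natDegree)
    (h : u.comp g = shearHom (φ.comp (algebraMap K (PowerSeries K)[X])) (φ X)
      (φ (C (algebraMap K (PowerSeries K) a₀ + PowerSeries.X))) f) :
    IsDecomposable₂ f := by
  set a : PowerSeries K := algebraMap K (PowerSeries K) a₀ + PowerSeries.X with ha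
  have hca : PowerSeries.constantCoeff a = a₀ := by
    simp [ha]
  have hclead : PowerSeries.constantCoeff (aeval a (leadingForm f)) =
      (leadingForm f).eval a₀ := by
    rw [aeval_def, hom_eval₂, hca, eval]
    congr 1
  have hunit : IsUnit (aeval a (leadingForm f)) := by
    rw [PowerSeries.isUnit_iff_constantCoeff, hclead]
    exact isUnit_iff_ne_zero.2 ha₀
  obtain ⟨u, g, hu, hud, hg, hgm, hlead, hnext, hcoeff, hcomp⟩ :=
    exists_integral_decomposition hφ hchar hunit hu hg h
  have hcharS : ∀ i, 0 < i → i ≤ f.totalDegree → (i : PowerSeries K) ≠ 0 := fun i h1 h2 h3 => by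
    rw [← map_natCast (algebraMap K (PowerSeries K)),
      map_eq_zero_iff _ (algebraMap K (PowerSeries K)).injective] at h3
    exact hchar i h1 h2 h3
  let Ds : Derivation K (PowerSeries K)[X] (PowerSeries K)[X] :=
    (PowerSeries.derivative K).onCoeffs
  let Dt : Derivation K (PowerSeries K)[X] (PowerSeries K)[X] :=
    (derivative' (R := PowerSeries K)).restrictScalars K
  have hDt : ∀ p, Dt p = derivative p := fun p => rfl
  have hzero : Dt.onCoeffs u = 0 := by
    refine onCoeffs_eq_zero_of_comp Ds Dt hu hg hgm ?_ ?_ ?_ ?_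
    · rw [← map_natCast (C : PowerSeries K →+* _), Ne, C_eq_zero]
      exact hcharS _ (by omega) hud
    · rw [hlead, hDt, derivative_C]
    · rw [hnext, map_zero]
    · rw [hcomp]
      refine onCoeffs_shearHom Ds Dt ?_ ?_ ?_ ?_ f
      · exact Derivation.onCoeffs_X _
      · simp [Ds, Derivation.onCoeffs_C, ha]
      · rw [hDt, derivative_X]
      · rw [hDt, derivative_C]
  -- In characteristic p a vanishing derivative alone would allow powers of t^p; the bound d < p on
  -- the degree in t excludes them.
  have hconst : ∀ i, (u.coeff i).natDegree = 0 := fun i => by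
    refine natDegree_eq_zero_of_derivative hcharS (hcoeff i) ?_
    rw [← hDt, ← Dt.coeff_onCoeffs, hzero, coeff_zero]
  set ε : (PowerSeries K)[X] →+* K[X] := mapRingHom PowerSeries.constantCoeff with hε
  set u₀ : K[X] := u.map (constantCoeff.comp ε) with hu₀
  have hu₀C : u₀.map C = u.map ε := by
    ext1 i
    rw [coeff_map, hu₀, coeff_map, coeff_map, eq_C_of_natDegree_eq_zero (hconst i)]
    simp [hε]
  have hε₁ : ε.comp (algebraMap K (PowerSeries K)[X]) = C := by
    ext1 x
    rw [RingHom.comp_apply, Polynomial.algebraMap_apply, hε, coe_mapRingHom, map_C,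
      PowerSeries.algebraMap_apply, PowerSeries.constantCoeff_C, Algebra.algebraMap_self_apply]
  have hεX : ε X = X := map_X _
  have hεa : ε (C a) = C a₀ := by rw [hε, coe_mapRingHom, map_C, hca]
  refine isDecomposable₂_of_unshear hf (u := u₀) (g := g.map ε) (a := a₀) ?_ ?_
  · refine hu.trans (le_natDegree_of_ne_zero ?_)
    rw [hu₀, coeff_map, coeff_natDegree, hlead]
    simpa [hε, hclead] using ha₀
  · rw [hu₀C, ← map_comp, hcomp, map_shearHom, hε₁, hεX, hεa]

end Descent

/-! ### Expanding α around a₀ and extending the embedding to algebraic closures. -/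

section Embedding

theorem injective_eval₂Hom_C_X_X {K : Type*} [Field K] :
    Function.Injective (MvPolynomial.eval₂Hom ((C : K[X] →+* K[X][X]).comp C) ![C X, X]) := by
  set ψ := MvPolynomial.eval₂Hom ((C : K[X] →+* K[X][X]).comp C) ![C X, X] with hψ
  let θ : K[X][X] →+* MvPolynomial (Fin 2) K :=
    eval₂RingHom (aeval (R := K) (MvPolynomial.X 0 : MvPolynomial (Fin 2) K)).toRingHom
      (MvPolynomial.X 1)
  have : θ.comp ψ = RingHom.id _ := by
    refine MvPolynomial.ringHom_ext (fun c => ?_) (fun i => ?_)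
    · simp [θ, ψ, MvPolynomial.algebraMap_eq]
    · fin_cases i <;> simp [θ, ψ]
  exact Function.LeftInverse.injective (g := θ) fun x => congrArg (fun h => h x) this

/-- The embedding of `K[α, t]` in `K⟦s⟧[t]` with `α ↦ a₀ + s`. -/
theorem exists_injective_powerSeries {K : Type*} [Field K] (a₀ : K) :
    ∃ τ : MvPolynomial (Fin 2) K →+* (PowerSeries K)[X], Function.Injective τ ∧
      (∀ c, τ (MvPolynomial.C c) = algebraMap K (PowerSeries K)[X] c) ∧
      τ (MvPolynomial.X 0) = C (algebraMap K (PowerSeries K) a₀ + PowerSeries.X) ∧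
      τ (MvPolynomial.X 1) = X := by
  let σ : K[X] →+* PowerSeries K :=
    (Polynomial.coeToPowerSeries.ringHom (R := K)).comp (taylorAlgHom a₀ : K[X] →+* K[X])
  have hσ : Function.Injective σ :=
    (Polynomial.coe_injective K).comp (taylor_injective a₀)
  refine ⟨(mapRingHom σ).comp (MvPolynomial.eval₂Hom (C.comp C) ![C X, X]),
    (map_injective σ hσ).comp injective_eval₂Hom_C_X_X, ?_, ?_, ?_⟩
  · intro c
    simp [σ, Polynomial.algebraMap_apply]
  · simp [σ, add_comm]
  · simp

theorem algebraicIndependent_alphaVar_tVar (k : Type*) [Field k] :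
    AlgebraicIndependent k ![alphaVar k, tVar k] := by
  have h : ![alphaVar k, tVar k] = fun i => algebraMap (MvPolynomial (Fin 2) k)
      (AlgebraicClosure (FunField k)) (MvPolynomial.X i) := by
    funext i
    rw [IsScalarTower.algebraMap_apply (MvPolynomial (Fin 2) k) (FunField k)]
    fin_cases i <;> rfl
  rw [h]
  exact (MvPolynomial.algebraicIndependent_X (Fin 2) k).map'
    (f := IsScalarTower.toAlgHom k (MvPolynomial (Fin 2) k) (AlgebraicClosure (FunField k)))
    (by
      rw [IsScalarTower.coe_toAlgHom', IsScalarTower.algebraMap_eq _ (FunField k)]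
      exact (algebraMap (FunField k) _).injective.comp (IsFractionRing.injective _ (FunField k)))

/-- Every embedding of `k̄[α, t]` in an algebraically closed field extends to the algebraic closure
of `k(α, t)`. -/
theorem exists_ringHom_extending {k : Type*} [Field k]
    (ι : AlgebraicClosure k →ₐ[k] AlgebraicClosure (FunField k)) {E : Type*} [Field E]
    [IsAlgClosed E] (τ : MvPolynomial (Fin 2) (AlgebraicClosure k) →+* E)
    (hτ : Function.Injective τ) :
    ∃ Ψ : AlgebraicClosure (FunField k) →+* E,
      (∀ c, Ψ (ι c) = τ (MvPolynomial.C c)) ∧ Ψ (alphaVar k) = τ (MvPolynomial.X 0) ∧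
      Ψ (tVar k) = τ (MvPolynomial.X 1) := by
  let algι : Algebra (AlgebraicClosure k) (AlgebraicClosure (FunField k)) :=
    ι.toRingHom.toAlgebra
  have : IsScalarTower k (AlgebraicClosure k) (AlgebraicClosure (FunField k)) :=
    IsScalarTower.of_algebraMap_eq fun x => (ι.commutes x).symm
  have hind : AlgebraicIndependent (AlgebraicClosure k) ![alphaVar k, tVar k] :=
    (algebraicIndependent_alphaVar_tVar k).extendScalars _
  let ρ : MvPolynomial (Fin 2) (AlgebraicClosure k) →+* AlgebraicClosure (FunField k) :=
    (MvPolynomial.aeval ![alphaVar k, tVar k]).toRingHom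
  have hρ : Function.Injective ρ := hind
  let algρ : Algebra (MvPolynomial (Fin 2) (AlgebraicClosure k)) (AlgebraicClosure (FunField k)) :=
    ρ.toAlgebra
  let algτ : Algebra (MvPolynomial (Fin 2) (AlgebraicClosure k)) E := τ.toAlgebra
  have : Module.IsTorsionFree (MvPolynomial (Fin 2) (AlgebraicClosure k))
    (AlgebraicClosure (FunField k)) := Module.isTorsionFree_iff_algebraMap_injective.2 hρ
  have : Module.IsTorsionFree (MvPolynomial (Fin 2) (AlgebraicClosure k)) E :=
    Module.isTorsionFree_iff_algebraMap_injective.2 hτ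
  -- Algebraicity over k[α, t] passes to the larger ring, where coefficients embed through ι; this
  -- permits `IsAlgClosed.lift`.
  have : Algebra.IsAlgebraic (MvPolynomial (Fin 2) (AlgebraicClosure k))
      (AlgebraicClosure (FunField k)) := by
    let _ : Algebra (MvPolynomial (Fin 2) k) (MvPolynomial (Fin 2) (AlgebraicClosure k)) :=
      (MvPolynomial.map (algebraMap k (AlgebraicClosure k))).toAlgebra
    have : IsScalarTower (MvPolynomial (Fin 2) k) (MvPolynomial (Fin 2) (AlgebraicClosure k))
        (AlgebraicClosure (FunField k)) := by
      refine IsScalarTower.of_algebraMap_eq' ?_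
      rw [IsScalarTower.algebraMap_eq (MvPolynomial (Fin 2) k) (FunField k)]
      refine MvPolynomial.ringHom_ext (fun c => ?_) (fun i => ?_)
      · change _ = ρ (MvPolynomial.map _ (MvPolynomial.C c))
        rw [MvPolynomial.map_C]
        change _ = MvPolynomial.aeval ![alphaVar k, tVar k] (MvPolynomial.C _)
        rw [MvPolynomial.aeval_C, ← IsScalarTower.algebraMap_apply,
          IsScalarTower.algebraMap_apply k (FunField k),
          IsScalarTower.algebraMap_apply k (MvPolynomial (Fin 2) k) (FunField k)]
        rfl
      · change _ = ρ (MvPolynomial.map _ (MvPolynomial.X i))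
        rw [MvPolynomial.map_X]
        change _ = MvPolynomial.aeval ![alphaVar k, tVar k] (MvPolynomial.X i)
        rw [MvPolynomial.aeval_X]
        fin_cases i <;> rfl
    have : Algebra.IsAlgebraic (MvPolynomial (Fin 2) k) (AlgebraicClosure (FunField k)) :=
      (IsFractionRing.comap_isAlgebraic_iff (K := FunField k)).2 inferInstance
    exact Algebra.IsAlgebraic.extendScalars
      (R := MvPolynomial (Fin 2) k) (MvPolynomial.map_injective _ (algebraMap k _).injective)
  let Ψ : AlgebraicClosure (FunField k) →ₐ[MvPolynomial (Fin 2) (AlgebraicClosure k)] E :=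
    IsAlgClosed.lift
  have hΨ : ∀ x, Ψ (ρ x) = τ x := fun x => Ψ.commutes x
  have hρC : ∀ c, ρ (MvPolynomial.C c) = ι c := fun c =>
    MvPolynomial.aeval_C ![alphaVar k, tVar k] c
  have hρX : ∀ i, ρ (MvPolynomial.X i) = ![alphaVar k, tVar k] i := fun i =>
    MvPolynomial.aeval_X _ i
  refine ⟨Ψ.toRingHom, fun c => ?_, ?_, ?_⟩
  · rw [← hΨ, hρC]; rfl
  · rw [← hΨ, hρX]; rfl
  · rw [← hΨ, hρX]; rfl

end Embedding

theorem theorem3 {k : Type*} [Field k]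
    (ι : AlgebraicClosure k →ₐ[k] AlgebraicClosure (FunField k))
    (f : MvPolynomial (Fin 2) (AlgebraicClosure k))
    (hf : IsIndecomposable₂ f)
    (hchar : ringChar k = 0 ∨ f.totalDegree < ringChar k) :
    IsIndecomposable₁ (shear ι f) := by
  obtain ⟨hpos, hind⟩ := hf
  set K := AlgebraicClosure k
  have hcharK : ∀ i, 0 < i → i ≤ f.totalDegree → (i : K) ≠ 0 := by
    intro i hi hid h0
    rw [← map_natCast (algebraMap k K), map_eq_zero, ringChar.spec] at h0
    rcases hchar with h | h
    · rw [h, zero_dvd_iff] at h0; omega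
    · have := Nat.le_of_dvd hi h0; omega
  -- A nonzero polynomial over an infinite field does not vanish identically.
  obtain ⟨a₀, ha₀⟩ : ∃ a₀ : K, (leadingForm f).eval a₀ ≠ 0 := by
    by_contra! h
    exact leadingForm_ne_zero hpos (Polynomial.funext fun x => by rw [h x, eval_zero])
  let E := AlgebraicClosure (FractionRing (PowerSeries K)[X])
  let φ : (PowerSeries K)[X] →+* E :=
    (algebraMap (FractionRing (PowerSeries K)[X]) E).comp (algebraMap _ _)
  have hφ : Function.Injective φ := (algebraMap (FractionRing (PowerSeries K)[X]) E).injective.comp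
    (IsFractionRing.injective _ _)
  obtain ⟨τ, hτ, hτC, hτ₀, hτ₁⟩ := exists_injective_powerSeries a₀
  obtain ⟨Ψ, hΨC, hΨα, hΨt⟩ := exists_ringHom_extending ι (φ.comp τ) (hφ.comp hτ)
  have hmap : (shear ι f).map Ψ = shearHom (φ.comp (algebraMap K (PowerSeries K)[X])) (φ X)
      (φ (C (algebraMap K (PowerSeries K) a₀ + PowerSeries.X))) f := by
    have h1 : shear ι f = shearHom ι.toRingHom (tVar k) (alphaVar k) f := rfl
    have h2 : Ψ.comp ι.toRingHom = φ.comp (algebraMap K (PowerSeries K)[X]) := by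
      ext1 c
      exact (hΨC c).trans (congrArg φ (hτC c))
    rw [h1, map_shearHom, h2, hΨα, hΨt, RingHom.comp_apply φ τ, RingHom.comp_apply φ τ, hτ₀, hτ₁]
  refine ⟨?_, ?_⟩
  -- If the coefficient of x^d vanished, its image P(a₀ + s) would vanish too, hence P(a₀) = 0 at s
  -- = 0.
  · refine lt_of_lt_of_le hpos (le_natDegree_of_ne_zero fun h0 => ha₀ ?_)
    have h1 := congrArg Ψ h0
    rw [← coeff_map, hmap, coeff_shearHom_totalDegree, map_zero] at h1
    have h2 : φ (C (aeval (algebraMap K (PowerSeries K) a₀ + PowerSeries.X) (leadingForm f))) =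
        0 := by
      rw [← h1, aeval_def]
      exact hom_eval₂ _ _ (φ.comp C) _
    rw [map_eq_zero_iff _ hφ, C_eq_zero] at h2
    have h3 := congrArg PowerSeries.constantCoeff h2
    have h4 : PowerSeries.constantCoeff.comp (algebraMap K (PowerSeries K)) = RingHom.id K := rfl
    rw [aeval_def, hom_eval₂, map_zero, h4, map_add, PowerSeries.constantCoeff_X, add_zero] at h3
    exact h3
  · rintro ⟨-, u, g, hu, hg, h⟩
    refine hind (isDecomposable₂_of_shear_decomposition hφ hpos hcharK ha₀ (u := u.map Ψ)
      (g := g.map Ψ) ?_ ?_ ?_)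
    · rwa [natDegree_map]
    · rwa [natDegree_map]
    · rw [← map_comp, ← h, hmap]
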